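/- Theorem 3.1. Let $\alpha\ge 1$ and $n\ge 2$ be integers, put $\beta=\lfloor\alpha/2\rfloor$ (so $\alpha=2\beta+1$ or $\alpha=2\beta$) and $N=\lfloor(\alpha-1)n/2\rfloor$. The system of linear equations $$\sum_{j=0}^{N}\Gamma\!\left(\tfrac12+\beta n+m-j\right)\Gamma\!\left(\tfrac{n-1}2+j\right)a_{\alpha,n,2j}= \begin{cases} \displaystyle 2\,\frac{(2m)!}{n^{m}}\sum_{(m)}\prod_{i=1}^{n}\frac{\Gamma(\frac12+\beta+m_i)}{(2m_i)!}, & \alpha=2\beta+1,\\[2ex] \displaystyle 2\,\frac{(2m+n)!}{n^{m+n/2}}\sum_{(m)}\prod_{i=1}^{n}\frac{\Gamma(\frac12+\beta+m_i)}{(2m_i+1)!}, & \alpha=2\beta, \end{cases}\qquad m=0,\dots,N,$$ where $\sum_{(m)}$ is the sum over all $(m_1,\dots,m_n)$ of non-negative integers with $m_1+\dots+m_n=m$, has a unique real solution $(a_{\alpha,n,2j})_{j=0,\dots,N}$. If $X_1,\dots,X_n$ are independent random variables, each with the gamma density $x^{\alpha-1}e^{-x}/\Gamma(\alpha)$ on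 $x>0$, and $\Phi$ is the angle between the vectors $(X_1,\dots,X_n)$ and $(1,\dots,1)$ in Euclidean $\mathbb R^n$, then, with these coefficients, $$\Pr\{\tan\Phi\le t\}=\frac{\Gamma(\alpha n)}{\Gamma(\alpha)^{n}\,n^{\alpha n/2}}\sum_{j=0}^{N}a_{\alpha,n,2j}\,\frac{t^{\,n-1+2j}}{n-1+2j}\qquad\text{for } 0\le t\le (n-1)^{-1/2}.$$ -/

import Mathlib

open MeasureTheory ProbabilityTheory
open scoped Nat

noncomputable section

/-- The angle `Φ ∈ [0, π]` between the vector `x = (x₁, …, xₙ)` and `(1, …, 1)` in Euclidean `n`-space. -/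
def diagAngle (n : ℕ) (x : Fin n → ℝ) : ℝ :=
  InnerProductGeometry.angle
    (WithLp.toLp 2 x : EuclideanSpace ℝ (Fin n)) (WithLp.toLp 2 (fun _ => (1 : ℝ)))

/-- The integer `[(α - 1) n / 2]` (for `α ≥ 1`; the division rounds down). -/
def topIndex (α n : ℕ) : ℕ := (α - 1) * n / 2

/-- The right-hand side of the `m`-th linear equation. With `β = ⌊α / 2⌋`, the number `α` is
`2 β + 1` or `2 β`; the inner sum is over all `k : Fin n → ℕ` with `∑ i, k i = m`. -/
def coeffRHS (α n m : ℕ) : ℝ :=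
  let β : ℕ := α / 2
  if Odd α then
    2 * ((2 * m)! : ℝ) / (n : ℝ) ^ m *
      ∑ k ∈ Finset.piAntidiag (Finset.univ : Finset (Fin n)) m,
        ∏ i, Real.Gamma (1 / 2 + (β : ℝ) + (k i : ℝ)) / ((2 * k i)! : ℝ)
  else
    2 * ((2 * m + n)! : ℝ) / (n : ℝ) ^ ((m : ℝ) + (n : ℝ) / 2) *
      ∑ k ∈ Finset.piAntidiag (Finset.univ : Finset (Fin n)) m,
        ∏ i, Real.Gamma (1 / 2 + (β : ℝ) + (k i : ℝ)) / ((2 * k i + 1)! : ℝ)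

/-- The linear system for the coefficients; the entry `a j` is `a_{α,n,2j}`. -/
def SolvesCoeffSystem (α n : ℕ) (a : Fin (topIndex α n + 1) → ℝ) : Prop :=
  ∀ m : Fin (topIndex α n + 1),
    ∑ j : Fin (topIndex α n + 1),
      Real.Gamma (1 / 2 + ((α / 2 : ℕ) : ℝ) * (n : ℝ) + ((m : ℕ) : ℝ) - ((j : ℕ) : ℝ)) *
        Real.Gamma (((n : ℝ) - 1) / 2 + ((j : ℕ) : ℝ)) * a j
      = coeffRHS α n (m : ℕ)

end

/-! Write x = (s/√n)(1, …, 1) + u with u orthogonal to the diagonal, so that ∑ xᵢ = √n s and |x|² =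
s² + ‖u‖². With p = α - 1, expand ∏ xᵢ ^ p = ∑ₖ s ^ (pn - k) Pₖ(u), where Pₖ is homogeneous of
degree k. In polar coordinates on the (n - 1)-dimensional hyperplane, Pₖ enters integrals against
radial functions only through one constant bₖ, and bₖ = 0 for odd k. The coefficients are a_{2j} = C
b_{2j}, where C is the Jacobian constant of the splitting.

For t ≤ (n - 1) ^ (-1/2) the cone tan Φ ≤ t lies in the positive orthant, where the joint density is
a constant times ∏ xᵢ ^ p · exp(-√n s). Integrating over ‖u‖ ≤ ts and then over s gives the stated
polynomial in t.

The same constants satisfy the linear system: compute ∫ (∑ xᵢ) ^ M ∏ xᵢ ^ p exp(-|x|²) by the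
multinomial theorem and by the splitting, and compare. Uniqueness holds because, after reversing the
unknowns and rescaling them by Gamma factors, the matrix is a Gram matrix. -/

/-! ### Polar integration of homogeneous functions -/

/-- Polar coordinates for a homogeneous function times a radial function. -/
theorem exists_integral_homogeneous_mul_norm {E : Type*} [NormedAddCommGroup E] [NormedSpace ℝ E]
    [Nontrivial E] [FiniteDimensional ℝ E] [MeasurableSpace E] [BorelSpace E] (μ : Measure E)
    [μ.IsAddHaarMeasure] (k : ℕ) (p : E → ℝ) (hp : ∀ (r : ℝ) (u : E), p (r • u) = r ^ k * p u) :
    ∃ c : ℝ, (Odd k → c = 0) ∧ ∀ h : ℝ → ℝ, ∫ u, p u * h ‖u‖ ∂μ =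
      c * ∫ r in Set.Ioi (0 : ℝ), r ^ (k + (Module.finrank ℝ E - 1)) * h r := by
  set d := Module.finrank ℝ E - 1
  set c := ∫ ω, p (ω : E) ∂μ.toSphere
  -- No integrability of `h` is needed: the changes of variables are measurable embeddings, and
  -- `integral_prod_mul` is unconditional.
  have key : ∀ h : ℝ → ℝ, ∫ u, p u * h ‖u‖ ∂μ =
      c * ∫ r in Set.Ioi (0 : ℝ), r ^ (k + d) * h r := by
    intro h
    calc ∫ u, p u * h ‖u‖ ∂μ
        = ∫ u : ({(0)}ᶜ : Set E), p u.1 * h ‖u.1‖ ∂(μ.comap (↑)) := by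
          rw [integral_subtype_comap (measurableSet_singleton _).compl
            fun x ↦ p x * h (‖x‖), restrict_compl_singleton]
      _ = ∫ z : (Metric.sphere (0 : E) 1) × (Set.Ioi (0 : ℝ)),
            p (z.1 : E) * ((z.2 : ℝ) ^ k * h z.2) ∂μ.toSphere.prod (.volumeIoiPow d) := by
          rw [← μ.measurePreserving_homeomorphUnitSphereProd.integral_comp
            (Homeomorph.measurableEmbedding _)]
          refine integral_congr_ae (.of_forall fun u => ?_)
          have hu : ‖(u : E)‖ ≠ 0 := norm_ne_zero_iff.2 u.2
          have := hp ‖(u : E)‖ (‖(u : E)‖⁻¹ • (u : E))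
          rw [smul_smul, mul_inv_cancel₀ hu, one_smul] at this
          simp only [homeomorphUnitSphereProd_apply_snd_coe, homeomorphUnitSphereProd_apply_fst_coe]
          rw [this]
          ring
      _ = c * ∫ r : Set.Ioi (0 : ℝ), (r : ℝ) ^ k * h r ∂(.volumeIoiPow d) :=
          integral_prod_mul (fun ω : Metric.sphere (0 : E) 1 => p ω)
            (fun r : Set.Ioi (0 : ℝ) => (r : ℝ) ^ k * h r)
      _ = _ := by
          congr 1
          simp only [Measure.volumeIoiPow, ENNReal.ofReal]
          rw [integral_withDensity_eq_integral_smul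
            ((measurable_subtype_coe.pow_const _).real_toNNReal),
            integral_subtype_comap measurableSet_Ioi
              fun a ↦ Real.toNNReal (a ^ d) • (a ^ k * h a),
            setIntegral_congr_fun measurableSet_Ioi fun x hx ↦ ?_]
          simp only [NNReal.smul_def, Real.coe_toNNReal _ (pow_nonneg (Set.mem_Ioi.1 hx).le _),
            smul_eq_mul]
          ring
  refine ⟨c, fun hk => ?_, key⟩
  -- Test on the unit ball: for odd `k` the left side vanishes by u ↦ -u, while the radial integral
  -- is nonzero.
  have h1 := key ((Set.Ioc 0 1).indicator fun _ => 1)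
  have h0 : ∫ u, p u * (Set.Ioc (0 : ℝ) 1).indicator (fun _ => 1) ‖u‖ ∂μ = 0 := by
    have := integral_neg_eq_self (fun u => p u * (Set.Ioc (0 : ℝ) 1).indicator (fun _ => 1) ‖u‖) μ
    have hneg : ∀ u, p (-u) = - p u := fun u => by
      have := hp (-1) u
      rwa [neg_one_smul, hk.neg_one_pow, neg_one_mul] at this
    simp only [hneg, norm_neg, neg_mul, integral_neg] at this
    linarith
  have h2 : ∫ r in Set.Ioi (0 : ℝ), r ^ (k + d) * (Set.Ioc (0 : ℝ) 1).indicator (fun _ => 1) r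
      = 1 / (k + d + 1) := by
    calc _ = ∫ r in Set.Ioi (0 : ℝ), (Set.Ioc (0 : ℝ) 1).indicator (fun r => r ^ (k + d)) r := by
          congr 1; ext r; by_cases hr : r ∈ Set.Ioc (0 : ℝ) 1 <;> simp [hr]
      _ = ∫ r in (0 : ℝ)..1, r ^ (k + d) := by
          rw [setIntegral_indicator measurableSet_Ioc,
            Set.inter_eq_right.2 Set.Ioc_subset_Ioi_self,
            intervalIntegral.integral_of_le zero_le_one]
      _ = _ := by simp
  rw [h0, h2] at h1
  have : (1 : ℝ) / (k + d + 1) ≠ 0 := by positivity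
  exact (mul_eq_zero.1 h1.symm).resolve_right this

/-! ### Injectivity of the Gamma Hankel matrix -/

/-- The matrix `(Γ(x + m + i))` is injective, being the Gram matrix of the monomials for the
weight `s ^ (x - 1) * exp (-s)`. -/
theorem eq_zero_of_sum_Gamma_add_eq_zero (N : ℕ) (x : ℝ) (hx : 0 < x) (c : ℕ → ℝ)
    (h : ∀ m ≤ N, ∑ i ∈ Finset.range (N + 1), Real.Gamma (x + m + i) * c i = 0) :
    ∀ i ≤ N, c i = 0 := by
  set q : Polynomial ℝ := ∑ i ∈ Finset.range (N + 1), Polynomial.monomial i (c i) with hq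
  have hqc : ∀ i ≤ N, q.coeff i = c i := fun i hi => by
    simp [hq, Polynomial.finsetSum_coeff, Polynomial.coeff_monomial, Nat.lt_succ_of_le hi]
  have hqe : ∀ s, q.eval s = ∑ i ∈ Finset.range (N + 1), c i * s ^ i := fun s => by
    simp [hq, Polynomial.eval_finsetSum]
  have hterm : ∀ m i : ℕ, IntegrableOn (fun s : ℝ => Real.exp (-s) * s ^ (x + m + i - 1))
      (Set.Ioi 0) := fun m i => Real.GammaIntegral_convergent (by positivity)
  -- The quadratic form of the matrix at `c` is the weighted integral of q².
  have hsplit : ∀ s ∈ Set.Ioi (0 : ℝ), q.eval s ^ 2 * (Real.exp (-s) * s ^ (x - 1)) =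
      ∑ m ∈ Finset.range (N + 1), ∑ i ∈ Finset.range (N + 1),
        c m * c i * (Real.exp (-s) * s ^ (x + m + i - 1)) := by
    intro s hs
    rw [hqe, sq, Finset.sum_mul_sum, Finset.sum_mul]
    refine Finset.sum_congr rfl fun m _ => ?_
    rw [Finset.sum_mul]
    refine Finset.sum_congr rfl fun i _ => ?_
    rw [show x + m + i - 1 = (x - 1) + (m : ℝ) + (i : ℝ) by ring, Real.rpow_add hs,
      Real.rpow_add hs, Real.rpow_natCast, Real.rpow_natCast]
    ring
  have hint : IntegrableOn (fun s => q.eval s ^ 2 * (Real.exp (-s) * s ^ (x - 1))) (Set.Ioi 0) := by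
    refine IntegrableOn.congr_fun ?_ (fun s hs => (hsplit s hs).symm) measurableSet_Ioi
    exact integrable_finsetSum _ fun m _ => integrable_finsetSum _ fun i _ =>
      (hterm m i).const_mul _
  have hzero : ∫ s in Set.Ioi (0 : ℝ), q.eval s ^ 2 * (Real.exp (-s) * s ^ (x - 1)) = 0 := by
    rw [setIntegral_congr_fun measurableSet_Ioi hsplit,
      integral_finsetSum _ fun m _ => integrable_finsetSum _ fun i _ => (hterm m i).const_mul _]
    refine Finset.sum_eq_zero fun m hm => ?_
    rw [integral_finsetSum _ fun i _ => (hterm m i).const_mul _]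
    simp_rw [integral_const_mul]
    have hm := h m (Nat.lt_succ_iff.1 (Finset.mem_range.1 hm))
    calc _ = c m * ∑ i ∈ Finset.range (N + 1), Real.Gamma (x + m + i) * c i := by
          rw [Finset.mul_sum]
          refine Finset.sum_congr rfl fun i _ => ?_
          rw [Real.Gamma_eq_integral (by positivity)]
          ring
      _ = 0 := by rw [hm, mul_zero]
  have hae := (setIntegral_eq_zero_iff_of_nonneg_ae (ae_restrict_of_forall_mem measurableSet_Ioi
    fun s hs => mul_nonneg (sq_nonneg _)
      (mul_nonneg (Real.exp_pos _).le (Real.rpow_nonneg (Set.mem_Ioi.1 hs).le _))) hint).1 hzero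
  -- Otherwise the finite root set of `q` would have to contain almost every s > 0.
  have hq0 : q = 0 := by
    by_contra hne
    have hfin : volume {s : ℝ | q.eval s = 0} = 0 := by
      have : {s : ℝ | q.eval s = 0} = ↑q.roots.toFinset := by
        ext s; simp [hne]
      rw [this]
      exact (Finset.finite_toSet _).measure_zero _
    have : ∀ᵐ s ∂(volume.restrict (Set.Ioi (0 : ℝ))), False := by
      filter_upwards [hae, ae_restrict_mem measurableSet_Ioi,
        ae_restrict_of_ae (compl_mem_ae_iff.2 hfin)] with s h1 h2 h3
      have : q.eval s ^ 2 * (Real.exp (-s) * s ^ (x - 1)) = 0 := h1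
      have hpos : Real.exp (-s) * s ^ (x - 1) ≠ 0 :=
        (mul_pos (Real.exp_pos _) (Real.rpow_pos_of_pos h2 _)).ne'
      exact h3 (by simpa [hpos] using this)
    rw [Filter.eventually_false_iff_eq_bot, ae_eq_bot, Measure.restrict_eq_zero] at this
    simp at this
  intro i hi
  rw [← hqc i hi, hq0, Polynomial.coeff_zero]

/-! ### Splitting off the diagonal direction -/

/-- The hyperplane orthogonal to `(1, …, 1)`. -/
noncomputable abbrev diagHyperplane (n : ℕ) : Submodule ℝ (EuclideanSpace ℝ (Fin n)) :=
  (Submodule.span ℝ {(WithLp.toLp 2 (fun _ => (1 : ℝ)) : EuclideanSpace ℝ (Fin n))})ᗮ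

theorem sum_eq_zero_of_mem_diagHyperplane {n : ℕ} (u : diagHyperplane n) :
    ∑ i, (u : EuclideanSpace ℝ (Fin n)) i = 0 := by
  have := Submodule.mem_orthogonal_singleton_iff_inner_right.1 u.2
  simpa [PiLp.inner_apply] using this

theorem finrank_diagHyperplane {n : ℕ} (hn : 2 ≤ n) :
    Module.finrank ℝ (diagHyperplane n) = n - 1 := by
  obtain ⟨m, rfl⟩ : ∃ m, n = m + 1 := ⟨n - 1, by omega⟩
  have : Fact (Module.finrank ℝ (EuclideanSpace ℝ (Fin (m + 1))) = m + 1) := ⟨by simp⟩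
  rw [Nat.add_sub_cancel]
  refine Submodule.finrank_orthogonal_span_singleton fun h => ?_
  simpa using congrArg (fun x : EuclideanSpace ℝ (Fin (m + 1)) => x 0) h

theorem nontrivial_diagHyperplane {n : ℕ} (hn : 2 ≤ n) : Nontrivial (diagHyperplane n) :=
  Module.nontrivial_of_finrank_pos (R := ℝ) (by rw [finrank_diagHyperplane hn]; omega)

/-- The point with coordinate `s` along the unit diagonal vector and orthogonal part `u`. -/
noncomputable def diagSplitMap (n : ℕ) : (ℝ × diagHyperplane n) →ₗ[ℝ] (Fin n → ℝ) where
  toFun z i := z.1 * (√n)⁻¹ + (z.2 : EuclideanSpace ℝ (Fin n)) i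
  map_add' z w := by ext i; simp; ring
  map_smul' r z := by ext i; simp; ring

theorem diagSplitMap_apply {n : ℕ} (z : ℝ × diagHyperplane n) (i : Fin n) :
    diagSplitMap n z i = z.1 * (√n)⁻¹ + (z.2 : EuclideanSpace ℝ (Fin n)) i := rfl

theorem mul_inv_sqrt_natCast (n : ℕ) : (n : ℝ) * (√n)⁻¹ = √n := by
  rw [← div_eq_mul_inv, Real.div_sqrt]

theorem sum_diagSplitMap {n : ℕ} (z : ℝ × diagHyperplane n) :
    ∑ i, diagSplitMap n z i = √n * z.1 := by
  simp only [diagSplitMap_apply, Finset.sum_add_distrib, sum_eq_zero_of_mem_diagHyperplane]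
  rw [Finset.sum_const, Finset.card_univ, Fintype.card_fin, nsmul_eq_mul, mul_left_comm,
    mul_inv_sqrt_natCast, add_zero, mul_comm]

theorem sum_sq_diagSplitMap {n : ℕ} (hn : 2 ≤ n) (z : ℝ × diagHyperplane n) :
    ∑ i, diagSplitMap n z i ^ 2 = z.1 ^ 2 + ‖z.2‖ ^ 2 := by
  have h1 : ‖z.2‖ ^ 2 = ∑ i, (z.2 : EuclideanSpace ℝ (Fin n)) i ^ 2 := by
    rw [Submodule.coe_norm, EuclideanSpace.norm_sq_eq]
    simp
  have hc : (n : ℝ) * ((√n)⁻¹) ^ 2 = 1 := by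
    have : (n : ℝ) ≠ 0 := by positivity
    rw [inv_pow, Real.sq_sqrt (by positivity), mul_inv_cancel₀ this]
  calc ∑ i, diagSplitMap n z i ^ 2
      = ∑ i, ((z.1 * (√n)⁻¹) ^ 2 + 2 * (z.1 * (√n)⁻¹) * (z.2 : EuclideanSpace ℝ (Fin n)) i
        + (z.2 : EuclideanSpace ℝ (Fin n)) i ^ 2) :=
        Finset.sum_congr rfl fun i _ => by rw [diagSplitMap_apply]; ring
    _ = z.1 ^ 2 * ((n : ℝ) * ((√n)⁻¹) ^ 2) + ‖z.2‖ ^ 2 := by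
        rw [Finset.sum_add_distrib, Finset.sum_add_distrib, ← Finset.mul_sum,
          sum_eq_zero_of_mem_diagHyperplane, h1, Finset.sum_const, Finset.card_univ,
          Fintype.card_fin, nsmul_eq_mul]
        ring
    _ = _ := by rw [hc, mul_one]

theorem diagSplitMap_injective {n : ℕ} (hn : 2 ≤ n) : Function.Injective (diagSplitMap n) := by
  rw [← LinearMap.ker_eq_bot, LinearMap.ker_eq_bot']
  intro z hz
  have h := sum_sq_diagSplitMap hn z
  rw [hz] at h
  simp only [Pi.zero_apply, ne_eq, OfNat.ofNat_ne_zero, not_false_eq_true, zero_pow,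
    Finset.sum_const_zero] at h
  have h1 : z.1 = 0 := by nlinarith [sq_nonneg z.1, sq_nonneg ‖z.2‖]
  have h2 : ‖z.2‖ = 0 := by nlinarith [sq_nonneg z.1, sq_nonneg ‖z.2‖]
  exact Prod.ext h1 (norm_eq_zero.1 h2)

/-- `diagSplitMap` as a continuous linear equivalence. -/
noncomputable def diagSplit {n : ℕ} (hn : 2 ≤ n) : (ℝ × diagHyperplane n) ≃L[ℝ] (Fin n → ℝ) :=
  (LinearEquiv.ofInjectiveOfFinrankEq (diagSplitMap n) (diagSplitMap_injective hn) (by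
    rw [Module.finrank_prod, finrank_diagHyperplane hn, Module.finrank_self,
      Module.finrank_fin_fun]; omega)).toContinuousLinearEquiv

/-- The linear change of variables `diagSplitMap`, up to a constant factor. -/
theorem exists_integral_eq_mul_integral_diagSplitMap {n : ℕ} (hn : 2 ≤ n) :
    ∃ C : ℝ, ∀ f : (Fin n → ℝ) → ℝ,
      (∫ x, f x = C * ∫ z : ℝ × diagHyperplane n, f (diagSplitMap n z)) ∧
      (Integrable f → Integrable fun z : ℝ × diagHyperplane n => f (diagSplitMap n z)) := by
  have hme : MeasurableEmbedding (diagSplit hn) :=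
    (diagSplit hn).toHomeomorph.measurableEmbedding
  have : (volume : Measure (ℝ × diagHyperplane n)).IsAddHaarMeasure :=
    inferInstanceAs ((volume : Measure ℝ).prod (volume : Measure (diagHyperplane n))).IsAddHaarMeasure
  have : (Measure.map (diagSplit hn) volume).IsAddHaarMeasure :=
    (diagSplit hn).isAddHaarMeasure_map volume
  -- Uniqueness of Haar measure suffices: the value of the constant is irrelevant, since the same
  -- one enters the linear system and the probability.
  have h := Measure.isAddLeftInvariant_eq_smul (volume : Measure (Fin n → ℝ))
    (Measure.map (diagSplit hn) volume)
  have hpos := Measure.addHaarScalarFactor_pos_of_isAddHaarMeasure (volume : Measure (Fin n → ℝ))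
    (Measure.map (diagSplit hn) volume)
  set C := Measure.addHaarScalarFactor (volume : Measure (Fin n → ℝ))
    (Measure.map (diagSplit hn) volume)
  refine ⟨C, fun f => ⟨?_, fun hf => ?_⟩⟩
  · rw [h, integral_smul_nnreal_measure, hme.integral_map, NNReal.smul_def, smul_eq_mul]
    rfl
  · rw [h] at hf
    replace hf := (integrable_smul_measure (ENNReal.coe_ne_zero.2 hpos.ne') ENNReal.coe_ne_top).1 hf
    rw [hme.integrable_map_iff] at hf
    exact hf

/-! ### Homogeneous parts of the product of powers -/

/-- The degree `k` part in `u` of `∏ i, (s / √n + u i) ^ p`, without its power of `s`. -/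
noncomputable def diagPart (n p k : ℕ) (u : Fin n → ℝ) : ℝ :=
  (√n)⁻¹ ^ (p * n - k) *
    ∑ T ∈ Finset.powersetCard k (Finset.univ : Finset (Fin n × Fin p)), ∏ x ∈ T, u x.1

/-- Treat the product as one of pn linear factors, indexed by `Fin n × Fin p`; the subset `T`
records the factors that contribute `u`. -/
theorem prod_pow_eq_sum_diagPart (n p : ℕ) (s : ℝ) (u : Fin n → ℝ) :
    ∏ i, (s * (√n)⁻¹ + u i) ^ p =
      ∑ k ∈ Finset.range (p * n + 1), s ^ (p * n - k) * diagPart n p k u := by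
  classical
  calc ∏ i, (s * (√n)⁻¹ + u i) ^ p
      = ∏ x : Fin n × Fin p, (u x.1 + s * (√n)⁻¹) := by
        rw [Fintype.prod_prod_type]
        simp [add_comm]
    _ = ∑ k ∈ Finset.range (p * n + 1),
          ∑ T ∈ Finset.powersetCard k (Finset.univ : Finset (Fin n × Fin p)),
            (∏ x ∈ T, u x.1) * ∏ x ∈ Finset.univ \ T, (s * (√n)⁻¹) := by
        rw [Finset.prod_add, Finset.sum_powerset]
        simp [mul_comm]
    _ = _ := by
        refine Finset.sum_congr rfl fun k _ => ?_
        rw [diagPart, Finset.mul_sum, Finset.mul_sum]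
        refine Finset.sum_congr rfl fun T hT => ?_
        rw [Finset.prod_const, Finset.card_sdiff_of_subset (Finset.subset_univ _),
          (Finset.mem_powersetCard.1 hT).2, Finset.card_univ, Fintype.card_prod, Fintype.card_fin,
          Fintype.card_fin, mul_pow, mul_comm n p]
        ring

theorem diagPart_smul (n p k : ℕ) (r : ℝ) (u : Fin n → ℝ) :
    diagPart n p k (fun i => r * u i) = r ^ k * diagPart n p k u := by
  rw [diagPart, diagPart, mul_left_comm, Finset.mul_sum (Finset.powersetCard k _) _ (r ^ k)]
  congr 1
  refine Finset.sum_congr rfl fun T hT => ?_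
  rw [Finset.prod_mul_distrib, Finset.prod_const, (Finset.mem_powersetCard.1 hT).2]

theorem continuous_diagPart (n p k : ℕ) : Continuous (diagPart n p k) := by
  unfold diagPart
  fun_prop

/-- Each monomial has k factors, each at most ‖u‖ in absolute value. This dominates the integrand by
a radial function. -/
theorem exists_abs_diagPart_le (n p k : ℕ) : ∃ K : ℝ, ∀ u : diagHyperplane n,
    |diagPart n p k (u : EuclideanSpace ℝ (Fin n))| ≤ K * ‖u‖ ^ k := by
  refine ⟨|(√n)⁻¹ ^ (p * n - k)| *
    ∑ T ∈ Finset.powersetCard k (Finset.univ : Finset (Fin n × Fin p)), 1, fun u => ?_⟩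
  rw [diagPart, abs_mul, mul_assoc, Finset.sum_mul]
  refine mul_le_mul_of_nonneg_left ((Finset.abs_sum_le_sum_abs _ _).trans
    (Finset.sum_le_sum fun T hT => ?_)) (abs_nonneg _)
  rw [Finset.abs_prod, one_mul, ← (Finset.mem_powersetCard.1 hT).2, ← Finset.prod_const]
  refine Finset.prod_le_prod (fun _ _ => abs_nonneg _) fun x _ => ?_
  exact PiLp.norm_apply_le (u : EuclideanSpace ℝ (Fin n)) x.1

theorem integrable_diagPart_mul_norm {n : ℕ} (hn : 2 ≤ n) (p k : ℕ) (h : ℝ → ℝ)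
    (hm : Measurable h)
    (hi : IntegrableOn (fun r => r ^ (k + (n - 2)) * h r) (Set.Ioi 0)) :
    Integrable fun u : diagHyperplane n =>
      diagPart n p k (u : EuclideanSpace ℝ (Fin n)) * h ‖u‖ := by
  have := nontrivial_diagHyperplane hn
  obtain ⟨K, hK⟩ := exists_abs_diagPart_le n p k
  have h1 : Integrable fun u : diagHyperplane n => ‖u‖ ^ k * h ‖u‖ := by
    refine (integrable_fun_norm_addHaar (volume : Measure (diagHyperplane n))
      (f := fun r => r ^ k * h r)).2 ?_
    rw [finrank_diagHyperplane hn]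
    convert hi using 2 with r
    rw [smul_eq_mul, ← mul_assoc, ← pow_add, add_comm, show n - 1 - 1 = n - 2 by omega]
  refine (h1.const_mul K).mono ?_ (.of_forall fun u => ?_)
  · refine Measurable.aestronglyMeasurable (Measurable.mul ?_ (hm.comp measurable_norm))
    refine (continuous_diagPart n p k).measurable.comp ?_
    exact (Continuous.comp (PiLp.continuous_ofLp 2 _) continuous_subtype_val).measurable
  · rw [norm_mul, ← mul_assoc, norm_mul]
    refine mul_le_mul_of_nonneg_right ?_ (norm_nonneg _)
    exact (hK u).trans (le_abs_self _)

/-! ### Gaussian moments computed in two ways -/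

theorem integrable_pow_mul_exp_neg_sq (j : ℕ) :
    Integrable fun s : ℝ => s ^ j * Real.exp (-s ^ 2) := by
  have := integrable_rpow_mul_exp_neg_mul_sq one_pos (s := j) 
    (by have : (0 : ℝ) ≤ j := j.cast_nonneg; linarith)
  simpa using this

theorem integral_Ioi_pow_mul_exp_neg_sq (j : ℕ) :
    ∫ r in Set.Ioi (0 : ℝ), r ^ j * Real.exp (-r ^ 2) = Real.Gamma (((j : ℝ) + 1) / 2) / 2 := by
  have := integral_rpow_mul_exp_neg_rpow (p := 2) (q := j) two_pos
    (by have : (0 : ℝ) ≤ j := j.cast_nonneg; linarith)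
  simp only [Real.rpow_natCast, Real.rpow_two] at this
  rw [this]
  ring

theorem integral_pow_mul_exp_neg_sq_of_even {j : ℕ} (hj : Even j) :
    ∫ s : ℝ, s ^ j * Real.exp (-s ^ 2) = Real.Gamma (((j : ℝ) + 1) / 2) := by
  have := integral_comp_abs (f := fun s : ℝ => s ^ j * Real.exp (-s ^ 2))
  simp only [hj.pow_abs, sq_abs] at this
  rw [this, integral_Ioi_pow_mul_exp_neg_sq]
  ring

theorem integral_pow_mul_exp_neg_sq_of_odd {j : ℕ} (hj : Odd j) :
    ∫ s : ℝ, s ^ j * Real.exp (-s ^ 2) = 0 := by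
  have := integral_neg_eq_self (fun s : ℝ => s ^ j * Real.exp (-s ^ 2)) volume
  simp only [hj.neg_pow, even_two.neg_pow, neg_mul, integral_neg] at this
  linarith

theorem sum_range_eq_sum_range_two_mul (D : ℕ) (f : ℕ → ℝ) (hf : ∀ k, Odd k → f k = 0) :
    ∑ k ∈ Finset.range (D + 1), f k = ∑ j ∈ Finset.range (D / 2 + 1), f (2 * j) := by
  refine (Finset.sum_of_injOn (fun j => 2 * j) ?_ ?_ ?_ fun _ _ => rfl).symm
  · intro a _ b _ h
    simpa using h
  · intro j hj
    simp only [Finset.coe_range, Set.mem_Iio] at hj ⊢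
    omega
  · intro k hk hk'
    refine hf k (Nat.not_even_iff_odd.1 fun he => hk' ?_)
    refine ⟨k / 2, ?_, Nat.two_mul_div_two_of_even he⟩
    simp only [Finset.coe_range, Set.mem_Iio, Finset.mem_range] at hk ⊢
    omega

/-- Only exponents of the parity of `δ` survive in the multinomial expansion, since odd Gaussian
moments vanish. -/
theorem sum_piAntidiag_prod_eq_of_parity {n : ℕ} (m δ : ℕ) (F : ℕ → ℝ)
    (hF : ∀ j, (∀ i, j ≠ 2 * i + δ) → F j = 0) :
    ∑ k ∈ Finset.piAntidiag (Finset.univ : Finset (Fin n)) (2 * m + δ * n), ∏ i, F (k i) =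
      ∑ k ∈ Finset.piAntidiag (Finset.univ : Finset (Fin n)) m, ∏ i, F (2 * k i + δ) := by
  have hsum : ∀ k : Fin n → ℕ, ∑ i, (2 * k i + δ) = 2 * ∑ i, k i + δ * n := fun k => by
    rw [Finset.sum_add_distrib, ← Finset.mul_sum, Finset.sum_const, Finset.card_univ,
      Fintype.card_fin, smul_eq_mul, mul_comm n]
  refine (Finset.sum_of_injOn (fun (k : Fin n → ℕ) i => 2 * k i + δ) ?_ ?_ ?_ fun _ _ => rfl).symm
  · intro a _ b _ h
    ext i
    have := congrFun h i
    simp only at this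
    omega
  · intro k hk
    simp only [Finset.mem_coe, Finset.mem_piAntidiag, ne_eq, Finset.mem_univ, implies_true,
      and_true] at hk ⊢
    rw [hsum, hk]
  · intro k hk hk'
    by_contra hne
    have h : ∀ i, ∃ l, k i = 2 * l + δ := fun i => by
      by_contra! h
      exact hne (Finset.prod_eq_zero (Finset.mem_univ i) (hF _ h))
    choose l hl using h
    refine hk' ⟨l, ?_, funext fun i => (hl i).symm⟩
    simp only [Finset.mem_coe, Finset.mem_piAntidiag, ne_eq, Finset.mem_univ, implies_true,
      and_true] at hk ⊢
    have h3 : ∑ i, k i = 2 * ∑ i, l i + δ * n := by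
      rw [← hsum l]
      exact Finset.sum_congr rfl fun i _ => hl i
    have h4 : 2 * ∑ i, l i + δ * n = 2 * m + δ * n := h3.symm.trans hk
    exact Nat.eq_of_mul_eq_mul_left two_pos (Nat.add_right_cancel h4)

theorem integrable_prod_pow_mul_exp_neg_sq {n : ℕ} (k : Fin n → ℕ) :
    Integrable fun x : Fin n → ℝ => ∏ i, (x i ^ k i * Real.exp (-x i ^ 2)) :=
  Integrable.fintype_prod (f := fun i x => x ^ k i * Real.exp (-x ^ 2))
    (μ := fun _ : Fin n => (volume : Measure ℝ)) fun i => integrable_pow_mul_exp_neg_sq (k i)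

theorem sum_pow_mul_prod_pow_mul_exp_eq {n : ℕ} (M p : ℕ) (x : Fin n → ℝ) :
    (∑ i, x i) ^ M * ∏ i, (x i ^ p * Real.exp (-x i ^ 2)) =
      ∑ k ∈ Finset.piAntidiag (Finset.univ : Finset (Fin n)) M,
        (Nat.multinomial Finset.univ k : ℝ) * ∏ i, (x i ^ (k i + p) * Real.exp (-x i ^ 2)) := by
  rw [Finset.sum_pow_eq_sum_piAntidiag, Finset.sum_mul]
  refine Finset.sum_congr rfl fun k _ => ?_
  rw [mul_assoc, ← Finset.prod_mul_distrib]
  congr 1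
  refine Finset.prod_congr rfl fun i _ => ?_
  ring

/-- The Gaussian moment of `(∑ xᵢ) ^ M * ∏ xᵢ ^ p`, by the multinomial theorem. -/
theorem integral_sum_pow_mul_prod_pow_mul_exp {n : ℕ} (m δ p : ℕ) (hδ : Even (δ + p))
    (hδ' : δ ≤ 1) :
    ∫ x : Fin n → ℝ, (∑ i, x i) ^ (2 * m + δ * n) * ∏ i, (x i ^ p * Real.exp (-x i ^ 2)) =
      ((2 * m + δ * n)! : ℝ) * ∑ k ∈ Finset.piAntidiag (Finset.univ : Finset (Fin n)) m,
        ∏ i, Real.Gamma (((2 * k i + δ + p : ℕ) + 1) / 2) / ((2 * k i + δ)! : ℝ) := by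
  set F : ℕ → ℝ := fun j => (∫ s : ℝ, s ^ (j + p) * Real.exp (-s ^ 2)) / (j ! : ℝ) with hFdef
  have hF : ∀ j, (∀ i, j ≠ 2 * i + δ) → F j = 0 := fun j hj => by
    have : Odd (j + p) := by
      rw [← Nat.not_even_iff_odd]
      intro he
      have h2 : Even (j + δ) := by
        rw [Nat.even_add] at he hδ ⊢
        rw [he, hδ]
      have := Nat.even_iff.1 h2
      exact hj (j / 2) (by have := hj 0; omega)
    simp only [hFdef]
    rw [integral_pow_mul_exp_neg_sq_of_odd this, zero_div]
  simp_rw [sum_pow_mul_prod_pow_mul_exp_eq]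
  rw [integral_finsetSum _ fun k _ => (integrable_prod_pow_mul_exp_neg_sq _).const_mul _]
  simp_rw [integral_const_mul]
  calc _ = ∑ k ∈ Finset.piAntidiag (Finset.univ : Finset (Fin n)) (2 * m + δ * n),
          ((2 * m + δ * n)! : ℝ) * ∏ i, F (k i) := by
        refine Finset.sum_congr rfl fun k hk => ?_
        have hk' := (Finset.mem_piAntidiag.1 hk).1
        rw [integral_fintype_prod_volume_eq_prod
          (fun i (x : ℝ) => x ^ (k i + p) * Real.exp (-x ^ 2)), hFdef, Finset.prod_div_distrib]
        have hs := Nat.multinomial_spec (Finset.univ : Finset (Fin n)) k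
        rw [hk'] at hs
        have hs' : (∏ i, ((k i)! : ℝ)) * (Nat.multinomial Finset.univ k : ℝ)
          = ((2 * m + δ * n)! : ℝ) := by exact_mod_cast hs
        have hne : (∏ i, ((k i)! : ℝ)) ≠ 0 :=
          Finset.prod_ne_zero_iff.2 fun i _ => by positivity
        rw [← hs']
        field_simp
    _ = _ := by
        rw [← Finset.mul_sum, sum_piAntidiag_prod_eq_of_parity m δ F hF]
        congr 1
        refine Finset.sum_congr rfl fun k _ => Finset.prod_congr rfl fun i _ => ?_
        have : Even (2 * k i + δ + p) := by
          rw [add_assoc]; exact (even_two_mul _).add hδ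
        simp only [hFdef]
        rw [integral_pow_mul_exp_neg_sq_of_even this]

/-- The same moment, by splitting off the diagonal direction. -/
theorem integral_sum_pow_mul_prod_pow_mul_exp_eq_sum {n : ℕ} (hn : 2 ≤ n) (p M : ℕ) (C : ℝ)
    (hC : ∀ f : (Fin n → ℝ) → ℝ,
      (∫ x, f x = C * ∫ z : ℝ × diagHyperplane n, f (diagSplitMap n z)) ∧
      (Integrable f → Integrable fun z : ℝ × diagHyperplane n => f (diagSplitMap n z)))
    (b : ℕ → ℝ)
    (hb : ∀ k, ∀ h : ℝ → ℝ,
      ∫ u : diagHyperplane n, diagPart n p k (u : EuclideanSpace ℝ (Fin n)) * h ‖u‖ =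
        b k * ∫ r in Set.Ioi (0 : ℝ), r ^ (k + (n - 2)) * h r) :
    ∫ x : Fin n → ℝ, (∑ i, x i) ^ M * ∏ i, (x i ^ p * Real.exp (-x i ^ 2)) =
      ∑ k ∈ Finset.range (p * n + 1), C * √n ^ M *
        (∫ s : ℝ, s ^ (M + (p * n - k)) * Real.exp (-s ^ 2)) *
        (b k * (Real.Gamma (((k + (n - 2) : ℕ) + 1) / 2) / 2)) := by
  have hg : ∀ z : ℝ × diagHyperplane n,
      (∑ i, diagSplitMap n z i) ^ M *
        ∏ i, (diagSplitMap n z i ^ p * Real.exp (-diagSplitMap n z i ^ 2)) =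
      ∑ k ∈ Finset.range (p * n + 1), √n ^ M *
        ((z.1 ^ (M + (p * n - k)) * Real.exp (-z.1 ^ 2)) *
          (diagPart n p k (z.2 : EuclideanSpace ℝ (Fin n)) * Real.exp (-‖z.2‖ ^ 2))) := by
    intro z
    rw [sum_diagSplitMap, Finset.prod_mul_distrib, ← Real.exp_sum, Finset.sum_neg_distrib,
      sum_sq_diagSplitMap hn]
    simp only [diagSplitMap_apply]
    rw [prod_pow_eq_sum_diagPart, Finset.sum_mul, Finset.mul_sum]
    refine Finset.sum_congr rfl fun k _ => ?_
    rw [neg_add, Real.exp_add]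
    ring
  have hi : ∀ k, Integrable fun u : diagHyperplane n =>
      diagPart n p k (u : EuclideanSpace ℝ (Fin n)) * Real.exp (-‖u‖ ^ 2) := fun k =>
    integrable_diagPart_mul_norm hn p k (fun r => Real.exp (-r ^ 2)) (by fun_prop)
      (integrable_pow_mul_exp_neg_sq _).integrableOn
  rw [(hC _).1]
  simp_rw [hg]
  rw [Measure.volume_eq_prod ℝ (diagHyperplane n), integral_finsetSum _ fun k _ =>
    ((integrable_pow_mul_exp_neg_sq _).mul_prod (hi k)).const_mul _, Finset.mul_sum]
  refine Finset.sum_congr rfl fun k _ => ?_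
  rw [integral_const_mul,
    integral_prod_mul (fun s : ℝ => s ^ (M + (p * n - k)) * Real.exp (-s ^ 2))
      (fun u : diagHyperplane n =>
        diagPart n p k (u : EuclideanSpace ℝ (Fin n)) * Real.exp (-‖u‖ ^ 2)),
    hb k (fun r => Real.exp (-r ^ 2)), integral_Ioi_pow_mul_exp_neg_sq]
  ring

/-! ### The linear system: existence and uniqueness -/

/-- The parameter `δ` merges the two cases: it is 0 for odd α and 1 for even α, so that δ + p = 2β
and the moment exponent is M = 2m + δn. -/
theorem coeffRHS_eq {n : ℕ} (hn : 2 ≤ n) (α m δ p : ℕ) (hp : α = p + 1) (hδ : δ + p = 2 * (α / 2))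
    (hδ' : δ ≤ 1) :
    coeffRHS α n m = 2 / √n ^ (2 * m + δ * n) *
      (((2 * m + δ * n)! : ℝ) * ∑ k ∈ Finset.piAntidiag (Finset.univ : Finset (Fin n)) m,
        ∏ i, Real.Gamma (((2 * k i + δ + p : ℕ) + 1) / 2) / ((2 * k i + δ)! : ℝ)) := by
  have hG : ∀ l : ℕ, Real.Gamma (((2 * l + δ + p : ℕ) + 1) / 2) =
      Real.Gamma (1 / 2 + ((α / 2 : ℕ) : ℝ) + (l : ℝ)) := fun l => by
    rw [add_assoc, hδ]
    congr 1
    push_cast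
    ring
  have hsq : √(n : ℝ) ^ (2 * m) = (n : ℝ) ^ m := by
    rw [pow_mul, Real.sq_sqrt (Nat.cast_nonneg n)]
  simp_rw [hG]
  rw [coeffRHS]
  obtain rfl | rfl : δ = 0 ∨ δ = 1 := by omega
  · rw [if_pos (by rw [Nat.odd_iff]; omega)]
    simp only [zero_mul, add_zero, hsq]
    ring
  · rw [if_neg (by rw [Nat.odd_iff]; omega)]
    have h : (n : ℝ) ^ ((m : ℝ) + (n : ℝ) / 2) = √(n : ℝ) ^ (2 * m + n) := by
      rw [Real.rpow_add (by positivity), Real.rpow_natCast, pow_add, hsq, Real.sqrt_eq_rpow,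
        ← Real.rpow_mul_natCast (by positivity)]
      ring_nf
    simp only [one_mul, h]
    ring

/-- Equating the two evaluations of the moment with M = 2m + δn gives the m-th equation; odd `k`
drop out. -/
theorem solvesCoeffSystem_of_integral_diagPart {n : ℕ} (hn : 2 ≤ n) (α : ℕ) (hα : 0 < α) (C : ℝ)
    (hC : ∀ f : (Fin n → ℝ) → ℝ,
      (∫ x, f x = C * ∫ z : ℝ × diagHyperplane n, f (diagSplitMap n z)) ∧
      (Integrable f → Integrable fun z : ℝ × diagHyperplane n => f (diagSplitMap n z)))
    (b : ℕ → ℝ) (hb0 : ∀ k, Odd k → b k = 0)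
    (hb : ∀ k, ∀ h : ℝ → ℝ,
      ∫ u : diagHyperplane n, diagPart n (α - 1) k (u : EuclideanSpace ℝ (Fin n)) * h ‖u‖ =
        b k * ∫ r in Set.Ioi (0 : ℝ), r ^ (k + (n - 2)) * h r) :
    SolvesCoeffSystem α n (fun j => C * b (2 * j)) := by
  intro m
  obtain ⟨p, rfl⟩ : ∃ p, α = p + 1 := ⟨α - 1, by omega⟩
  rw [Nat.add_sub_cancel] at hb
  obtain ⟨δ, hδ', hδ⟩ : ∃ δ ≤ 1, δ + p = 2 * ((p + 1) / 2) :=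
    ⟨2 * ((p + 1) / 2) - p, by omega, by omega⟩
  have hev : Even (δ + p) := hδ ▸ even_two_mul _
  rw [coeffRHS_eq hn (p + 1) m δ p rfl hδ hδ',
    ← integral_sum_pow_mul_prod_pow_mul_exp m δ p hev hδ',
    integral_sum_pow_mul_prod_pow_mul_exp_eq_sum hn p _ C hC b hb,
    sum_range_eq_sum_range_two_mul (p * n) _ fun k hk => by rw [hb0 k hk]; ring]
  have hN : topIndex (p + 1) n = p * n / 2 := rfl
  rw [← hN, ← Fin.sum_univ_eq_sum_range (fun j => C * √n ^ (2 * (m : ℕ) + δ * n) *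
        (∫ s : ℝ, s ^ (2 * (m : ℕ) + δ * n + (p * n - 2 * j)) * Real.exp (-s ^ 2)) *
        (b (2 * j) * (Real.Gamma (((2 * j + (n - 2) : ℕ) + 1) / 2) / 2))) (topIndex (p + 1) n + 1),
    Finset.mul_sum]
  refine Finset.sum_congr rfl fun j _ => ?_
  have hj : 2 * (j : ℕ) ≤ p * n := by have := j.2; omega
  -- The power of `s` is 2(m + βn - j), whose Gaussian moment is Γ(1/2 + βn + m - j).
  have hexp : 2 * (m : ℕ) + δ * n + (p * n - 2 * j) = 2 * m + (2 * ((p + 1) / 2) * n - 2 * j) := by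
    rw [← hδ, add_mul]; omega
  have hj' : 2 * (j : ℕ) ≤ 2 * ((p + 1) / 2) * n := by
    rw [← hδ, add_mul]; omega
  have hev2 : Even (2 * (m : ℕ) + (2 * ((p + 1) / 2) * n - 2 * j)) :=
    ⟨m + (((p + 1) / 2) * n - j), by rw [mul_assoc]; omega⟩
  rw [hexp, integral_pow_mul_exp_neg_sq_of_even hev2]
  have h1 : ((2 * (m : ℕ) + (2 * ((p + 1) / 2) * n - 2 * j) : ℕ) + 1 : ℝ) / 2 =
      1 / 2 + (((p + 1) / 2 : ℕ) : ℝ) * (n : ℝ) + ((m : ℕ) : ℝ) - ((j : ℕ) : ℝ) := by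
    rw [Nat.cast_add, Nat.cast_sub hj']
    push_cast
    ring
  have h2 : ((2 * (j : ℕ) + (n - 2) : ℕ) + 1 : ℝ) / 2 = ((n : ℝ) - 1) / 2 + ((j : ℕ) : ℝ) := by
    rw [Nat.cast_add, Nat.cast_sub hn]
    push_cast
    ring
  rw [h1, h2]
  have : √(n : ℝ) ≠ 0 := by positivity
  field_simp

/-- With i = N - j the argument 1/2 + βn + m - j becomes x + m + i, a Hankel pattern; x > 0 because
N ≤ βn. The other Gamma factor is nonzero and is absorbed into the unknown. -/
theorem SolvesCoeffSystem.unique {n : ℕ} (hn : 2 ≤ n) {α : ℕ} (hα : 0 < α)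
    {a a' : Fin (topIndex α n + 1) → ℝ} (h : SolvesCoeffSystem α n a)
    (h' : SolvesCoeffSystem α n a') : a = a' := by
  set x : ℝ := 1 / 2 + ((α / 2 : ℕ) : ℝ) * (n : ℝ) - topIndex α n with hx
  have hNle : topIndex α n ≤ α / 2 * n := by
    have : (α - 1) * n ≤ (α / 2 * 2) * n := Nat.mul_le_mul_right _ (by omega)
    rw [topIndex]
    calc (α - 1) * n / 2 ≤ (α / 2 * 2) * n / 2 := Nat.div_le_div_right this
      _ = α / 2 * n := by rw [mul_right_comm, Nat.mul_div_cancel _ two_pos]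
  have hx0 : 0 < x := by
    have : (topIndex α n : ℝ) ≤ ((α / 2 : ℕ) : ℝ) * (n : ℝ) := by exact_mod_cast hNle
    rw [hx]; linarith
  set g : Fin (topIndex α n + 1) → ℝ := fun j =>
    Real.Gamma (((n : ℝ) - 1) / 2 + ((j : ℕ) : ℝ)) * (a j - a' j)
    with hg
  have hz := eq_zero_of_sum_Gamma_add_eq_zero (topIndex α n) x hx0
    (fun i => g (Fin.rev (Fin.ofNat (topIndex α n + 1) i))) fun m hm => by
      have e := (h ⟨m, Nat.lt_succ_of_le hm⟩).trans (h' ⟨m, Nat.lt_succ_of_le hm⟩).symm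
      rw [← sub_eq_zero, ← Finset.sum_sub_distrib] at e
      rw [← Fin.sum_univ_eq_sum_range (fun i => Real.Gamma (x + m + i) *
        g (Fin.rev (Fin.ofNat (topIndex α n + 1) i))), ← Equiv.sum_comp Fin.revPerm, ← e]
      refine Finset.sum_congr rfl fun j _ => ?_
      have hj : (j : ℕ) ≤ topIndex α n := Nat.lt_succ_iff.1 j.2
      rw [Fin.revPerm_apply, Fin.ofNat_eq_cast, Fin.cast_val_eq_self, Fin.rev_rev, Fin.val_rev,
        Nat.cast_sub j.2]
      have : x + m + ((topIndex α n + 1 : ℕ) - ((j : ℕ) + 1 : ℕ) : ℝ) =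
        1 / 2 + ((α / 2 : ℕ) : ℝ) * (n : ℝ) + (m : ℝ) - ((j : ℕ) : ℝ) := by
        rw [hx]; push_cast; ring
      rw [this, hg]
      ring
  ext j
  have hj := hz (Fin.rev j) (Nat.lt_succ_iff.1 (Fin.rev j).2)
  simp only [Fin.ofNat_eq_cast, Fin.cast_val_eq_self, Fin.rev_rev, hg] at hj
  have hn' : (2 : ℝ) ≤ n := by exact_mod_cast hn
  have hpos : 0 < ((n : ℝ) - 1) / 2 + ((j : ℕ) : ℝ) :=
    add_pos_of_pos_of_nonneg (by linarith) (Nat.cast_nonneg _)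
  exact sub_eq_zero.1 ((mul_eq_zero.1 hj).resolve_left (Real.Gamma_pos_of_pos hpos).ne')

/-! ### The joint gamma density -/

theorem integrable_gammaPDFReal {a r : ℝ} (ha : 0 < a) (hr : 0 < r) :
    Integrable (gammaPDFReal a r) := by
  refine ⟨(measurable_gammaPDFReal a r).aestronglyMeasurable, ?_⟩
  rw [hasFiniteIntegral_iff_ofReal (.of_forall (gammaPDFReal_nonneg ha hr))]
  exact (lintegral_gammaPDF_eq_one ha hr).trans_lt ENNReal.one_lt_top

/-- The joint density of independent gamma variables. -/
theorem pi_gammaMeasure_eq_withDensity {ι : Type*} [Fintype ι] {a r : ℝ} (ha : 0 < a)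
    (hr : 0 < r) :
    Measure.pi (fun _ : ι => gammaMeasure a r) =
      volume.withDensity fun x : ι → ℝ => ENNReal.ofReal (∏ i, gammaPDFReal a r (x i)) := by
  have := isProbabilityMeasure_gammaMeasure ha hr
  refine Measure.pi_eq fun s hs => ?_
  have hind : ∀ i, Integrable ((s i).indicator (gammaPDFReal a r)) := fun i =>
    (integrable_gammaPDFReal ha hr).indicator (hs i)
  have hnn : ∀ i x, 0 ≤ (s i).indicator (gammaPDFReal a r) x := fun i x =>
    Set.indicator_nonneg (fun x _ => gammaPDFReal_nonneg ha hr x) x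
  -- The indicator of a box factors over coordinates, so the integral is a product of
  -- one-dimensional ones.
  have hbox : ∀ x : ι → ℝ, (Set.univ.pi s).indicator
      (fun x => ENNReal.ofReal (∏ i, gammaPDFReal a r (x i))) x =
      ENNReal.ofReal (∏ i, (s i).indicator (gammaPDFReal a r) (x i)) := by
    intro x
    by_cases hx : x ∈ Set.univ.pi s
    · rw [Set.indicator_of_mem hx]
      congr 1
      exact Finset.prod_congr rfl fun i _ => (Set.indicator_of_mem (hx i (Set.mem_univ i)) _).symm
    · rw [Set.indicator_of_notMem hx]
      simp only [Set.mem_univ_pi, not_forall] at hx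
      obtain ⟨i, hi⟩ := hx
      rw [Finset.prod_eq_zero (Finset.mem_univ i) (Set.indicator_of_notMem hi _),
        ENNReal.ofReal_zero]
  rw [withDensity_apply _ (MeasurableSet.univ_pi hs),
    ← lintegral_indicator (MeasurableSet.univ_pi hs)]
  simp_rw [hbox]
  rw [volume_pi, ← ofReal_integral_eq_lintegral_ofReal
    (Integrable.fintype_prod (f := fun i => (s i).indicator (gammaPDFReal a r))
      (μ := fun _ => (volume : Measure ℝ)) hind)
    (.of_forall fun x => Finset.prod_nonneg fun i _ => hnn i _),
    integral_fintype_prod_eq_prod (μ := fun _ => (volume : Measure ℝ))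
      (fun i => (s i).indicator (gammaPDFReal a r)),
    ENNReal.ofReal_prod_of_nonneg fun i _ => integral_nonneg (hnn i)]
  refine Finset.prod_congr rfl fun i _ => ?_
  rw [ofReal_integral_eq_lintegral_ofReal (hind i) (.of_forall (hnn i)), gammaMeasure,
    withDensity_apply _ (hs i), ← lintegral_indicator (hs i)]
  refine lintegral_congr fun x => ?_
  by_cases hx : x ∈ s i <;> simp [hx, gammaPDF]

theorem integrable_prod_gammaPDFReal {ι : Type*} [Fintype ι] {a r : ℝ} (ha : 0 < a) (hr : 0 < r) :
    Integrable fun x : ι → ℝ => ∏ i, gammaPDFReal a r (x i) :=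
  Integrable.fintype_prod (μ := fun _ => (volume : Measure ℝ))
    fun _ => integrable_gammaPDFReal ha hr

theorem measureReal_preimage_eq_integral_gammaPDFReal {ι Ω : Type*} [Fintype ι]
    [MeasurableSpace Ω] (P : Measure Ω) [IsProbabilityMeasure P] (X : ι → Ω → ℝ) {a r : ℝ}
    (ha : 0 < a) (hr : 0 < r) (hX : ∀ i, HasLaw (X i) (gammaMeasure a r) P)
    (hind : iIndepFun X P) {S : Set (ι → ℝ)} (hS : MeasurableSet S) :
    P.real {ω | (fun i => X i ω) ∈ S} =
      ∫ x : ι → ℝ, S.indicator (fun x => ∏ i, gammaPDFReal a r (x i)) x := by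
  have hm : ∀ i, AEMeasurable (X i) P := fun i => (hX i).aemeasurable
  have hmap := (iIndepFun_iff_map_fun_eq_pi_map hm).1 hind
  simp_rw [fun i => (hX i).map_eq] at hmap
  rw [pi_gammaMeasure_eq_withDensity ha hr] at hmap
  have hnn : ∀ x : ι → ℝ, 0 ≤ ∏ i, gammaPDFReal a r (x i) := fun x =>
    Finset.prod_nonneg fun i _ => gammaPDFReal_nonneg ha hr _
  have h1 : P {ω | (fun i => X i ω) ∈ S} = Measure.map (fun ω i => X i ω) P S :=
    (Measure.map_apply_of_aemeasurable (aemeasurable_pi_lambda _ hm) hS).symm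
  rw [measureReal_def, h1, hmap, withDensity_apply _ hS, integral_indicator hS,
    integral_eq_lintegral_of_nonneg_ae (.of_forall hnn)
      (integrable_prod_gammaPDFReal ha hr).aestronglyMeasurable.restrict]

/-! ### The cone about the diagonal and its probability -/

theorem measurable_tan_diagAngle (n : ℕ) :
    Measurable fun x : Fin n → ℝ => Real.tan (diagAngle n x) := by
  have h : Measurable fun x : Fin n → ℝ => diagAngle n x := by
    unfold diagAngle InnerProductGeometry.angle
    have : Measurable fun x : Fin n → ℝ => (WithLp.toLp 2 x : EuclideanSpace ℝ (Fin n)) :=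
      (PiLp.continuous_toLp 2 _).measurable
    fun_prop
  simp_rw [Real.tan_eq_sin_div_cos]
  fun_prop

theorem tan_diagAngle_diagSplitMap {n : ℕ} (hn : 2 ≤ n) (z : ℝ × diagHyperplane n)
    (hz : 0 < z.1) : Real.tan (diagAngle n (diagSplitMap n z)) = ‖z.2‖ / z.1 := by
  set d : EuclideanSpace ℝ (Fin n) := WithLp.toLp 2 (fun _ => (1 : ℝ)) with hd
  have hn0 : (0 : ℝ) < √n := by positivity
  have hr : 0 < z.1 * (√n)⁻¹ := by positivity
  have hx : (WithLp.toLp 2 (diagSplitMap n z) : EuclideanSpace ℝ (Fin n)) =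
      (z.1 * (√n)⁻¹) • d + (z.2 : EuclideanSpace ℝ (Fin n)) := by
    ext i
    simp [diagSplitMap_apply, hd]
  have hin : inner ℝ ((z.1 * (√n)⁻¹) • d) (z.2 : EuclideanSpace ℝ (Fin n)) = 0 := by
    rw [real_inner_smul_left, Submodule.mem_orthogonal_singleton_iff_inner_right.1 z.2.2, mul_zero]
  have hnorm : ‖(z.1 * (√n)⁻¹) • d‖ = z.1 := by
    have : ‖d‖ = √n := by rw [EuclideanSpace.norm_eq]; simp [hd]
    rw [norm_smul, this, Real.norm_of_nonneg hr.le, mul_assoc, inv_mul_cancel₀ hn0.ne', mul_one]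
  rw [diagAngle, InnerProductGeometry.angle_comm, hx,
    ← InnerProductGeometry.angle_smul_left_of_pos d _ hr,
    InnerProductGeometry.tan_angle_add_of_inner_eq_zero hin, hnorm, Submodule.coe_norm]

/-- As the coordinates sum to zero, uᵢ² is the square of the sum of the other n - 1, to which
Cauchy–Schwarz applies. -/
theorem natCast_mul_sq_le_of_mem_diagHyperplane {n : ℕ} (u : diagHyperplane n) (i : Fin n) :
    (n : ℝ) * (u : EuclideanSpace ℝ (Fin n)) i ^ 2 ≤ ((n : ℝ) - 1) * ‖u‖ ^ 2 := by
  classical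
  set v := (u : EuclideanSpace ℝ (Fin n))
  have hnorm : ‖u‖ ^ 2 = ∑ j, v j ^ 2 := by
    rw [Submodule.coe_norm, EuclideanSpace.norm_sq_eq]
    simp [v]
  have h0 := sum_eq_zero_of_mem_diagHyperplane u
  rw [← Finset.add_sum_erase _ _ (Finset.mem_univ i)] at h0
  rw [← Finset.add_sum_erase _ _ (Finset.mem_univ i)] at hnorm
  have hcs := sq_sum_le_card_mul_sum_sq (s := Finset.univ.erase i) (f := fun j => v j)
  rw [Finset.card_erase_of_mem (Finset.mem_univ i), Finset.card_univ, Fintype.card_fin,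
    Nat.cast_sub (by have := i.2; omega), Nat.cast_one] at hcs
  have h1 : (∑ j ∈ Finset.univ.erase i, v j) ^ 2 = v i ^ 2 := by
    rw [← neg_sq (v i)]
    congr 1
    linarith
  rw [h1] at hcs
  rw [hnorm]
  linarith

/-- The cone of aperture `arctan ((n - 1) ^ (-1/2))` about the diagonal lies in the orthant. -/
theorem diagSplitMap_nonneg {n : ℕ} (hn : 2 ≤ n) {t : ℝ} (ht0 : 0 ≤ t)
    (ht : t ≤ ((n : ℝ) - 1) ^ (-(1 / 2) : ℝ)) (z : ℝ × diagHyperplane n) (hz : 0 < z.1)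
    (hzt : ‖z.2‖ ≤ t * z.1) (i : Fin n) : 0 ≤ diagSplitMap n z i := by
  have hn1 : (0 : ℝ) < (n : ℝ) - 1 := by
    have : (2 : ℝ) ≤ n := by exact_mod_cast hn
    linarith
  have hn0 : (0 : ℝ) < n := by positivity
  have ht2 : ((n : ℝ) - 1) * t ^ 2 ≤ 1 := by
    have h1 : t ^ 2 ≤ (((n : ℝ) - 1) ^ (-(1 / 2) : ℝ)) ^ 2 := by gcongr
    rw [← Real.rpow_mul_natCast hn1.le] at h1
    norm_num at h1
    rw [Real.rpow_neg_one] at h1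
    calc _ ≤ ((n : ℝ) - 1) * ((n : ℝ) - 1)⁻¹ := by gcongr
      _ = 1 := mul_inv_cancel₀ hn1.ne'
  have h1 := natCast_mul_sq_le_of_mem_diagHyperplane z.2 i
  set v := (z.2 : EuclideanSpace ℝ (Fin n)) i with hv
  have h2 : (n : ℝ) * v ^ 2 ≤ z.1 ^ 2 := by
    calc _ ≤ ((n : ℝ) - 1) * ‖z.2‖ ^ 2 := h1
      _ ≤ ((n : ℝ) - 1) * (t * z.1) ^ 2 := by gcongr
      _ = (((n : ℝ) - 1) * t ^ 2) * z.1 ^ 2 := by ring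
      _ ≤ 1 * z.1 ^ 2 := by gcongr
      _ = z.1 ^ 2 := one_mul _
  have h3 : |√n * v| ≤ z.1 := by
    refine abs_le_of_sq_le_sq ?_ hz.le
    rw [mul_pow, Real.sq_sqrt hn0.le]
    exact h2
  have h4 : 0 ≤ √n * (z.1 * (√n)⁻¹ + v) := by
    have : √(n : ℝ) ≠ 0 := by positivity
    rw [mul_add, mul_left_comm, mul_inv_cancel₀ this]
    linarith [(abs_le.1 h3).1]
  rw [diagSplitMap_apply]
  exact nonneg_of_mul_nonneg_right h4 (by positivity)

theorem prod_gammaPDFReal_of_nonneg {n : ℕ} {p : ℕ} (x : Fin n → ℝ) (hx : ∀ i, 0 ≤ x i) :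
    ∏ i, gammaPDFReal ((p + 1 : ℕ) : ℝ) 1 (x i) =
      (Real.Gamma ((p + 1 : ℕ) : ℝ) ^ n)⁻¹ * ((∏ i, x i ^ p) * Real.exp (-∑ i, x i)) := by
  have h : ∀ i, gammaPDFReal ((p + 1 : ℕ) : ℝ) 1 (x i) =
      (Real.Gamma ((p + 1 : ℕ) : ℝ))⁻¹ * (x i ^ p * Real.exp (-x i)) := fun i => by
    rw [gammaPDFReal, if_pos (hx i), Real.one_rpow, Nat.cast_add, Nat.cast_one,
      add_sub_cancel_right, Real.rpow_natCast, one_mul, one_div, mul_assoc]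
  simp_rw [h]
  rw [Finset.prod_mul_distrib, Finset.prod_mul_distrib, ← Real.exp_sum, Finset.sum_neg_distrib,
    Finset.prod_const, Finset.card_univ, Fintype.card_fin, inv_pow]

theorem indicator_cone_prod_gammaPDFReal {n : ℕ} (hn : 2 ≤ n) (p : ℕ) {t : ℝ} (ht0 : 0 ≤ t)
    (ht : t ≤ ((n : ℝ) - 1) ^ (-(1 / 2) : ℝ)) (z : ℝ × diagHyperplane n) (hz : z.1 ≠ 0) :
    {x | Real.tan (diagAngle n x) ≤ t}.indicator
        (fun x => ∏ i, gammaPDFReal ((p + 1 : ℕ) : ℝ) 1 (x i)) (diagSplitMap n z) =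
      (Set.Ioi (0 : ℝ)).indicator (fun s => (Real.Gamma ((p + 1 : ℕ) : ℝ) ^ n)⁻¹ *
        (∑ k ∈ Finset.range (p * n + 1), s ^ (p * n - k) * Real.exp (-(√n * s)) *
          (diagPart n p k (z.2 : EuclideanSpace ℝ (Fin n)) *
            (Set.Iic (t * s)).indicator 1 ‖z.2‖))) z.1 := by
  rcases lt_or_gt_of_ne hz with hneg | hpos
  · rw [Set.indicator_of_notMem (s := Set.Ioi (0 : ℝ)) (by simpa using hneg.le)]
    -- For s < 0 the angle condition gives no control, but the coordinate sum is negative, so some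
    -- coordinate is negative and the density vanishes.
    obtain ⟨i, hi⟩ : ∃ i, diagSplitMap n z i < 0 := by
      by_contra! h
      have := Finset.sum_nonneg fun i (_ : i ∈ Finset.univ) => h i
      rw [sum_diagSplitMap] at this
      have hn0 : (0 : ℝ) < √n := by positivity
      nlinarith
    refine Set.indicator_apply_eq_zero.2 fun _ => Finset.prod_eq_zero (Finset.mem_univ i) ?_
    rw [gammaPDFReal, if_neg hi.not_ge]
  · rw [Set.indicator_of_mem (s := Set.Ioi (0 : ℝ)) hpos]
    have htan := tan_diagAngle_diagSplitMap hn z hpos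
    by_cases hzt : ‖z.2‖ ≤ t * z.1
    · rw [Set.indicator_of_mem (by
        rw [Set.mem_ofPred_eq, htan]; exact (div_le_iff₀ hpos).2 hzt)]
      rw [prod_gammaPDFReal_of_nonneg _ (diagSplitMap_nonneg hn ht0 ht z hpos hzt),
        sum_diagSplitMap]
      simp only [diagSplitMap_apply, Set.indicator_of_mem (Set.mem_Iic.2 hzt), Pi.one_apply]
      rw [prod_pow_eq_sum_diagPart, Finset.sum_mul]
      congr 1
      exact Finset.sum_congr rfl fun k _ => by ring
    · rw [Set.indicator_of_notMem (by
        rw [Set.mem_ofPred_eq, htan, div_le_iff₀ hpos]; exact hzt)]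
      rw [Finset.sum_eq_zero fun k _ => ?_, mul_zero]
      rw [Set.indicator_of_notMem (s := Set.Iic (t * z.1)) (Set.mem_Iic.not.2 hzt), mul_zero,
        mul_zero]

theorem integral_Ioi_pow_mul_indicator_Iic (q : ℕ) {R : ℝ} (hR : 0 ≤ R) :
    ∫ r in Set.Ioi (0 : ℝ), r ^ q * (Set.Iic R).indicator 1 r = R ^ (q + 1) / (q + 1) := by
  calc _ = ∫ r in Set.Ioi (0 : ℝ), (Set.Iic R).indicator (fun r => r ^ q) r := by
        congr 1; ext r; by_cases hr : r ∈ Set.Iic R <;> simp [hr]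
    _ = ∫ r in (0 : ℝ)..R, r ^ q := by
        rw [setIntegral_indicator measurableSet_Iic, Set.Ioi_inter_Iic,
          intervalIntegral.integral_of_le hR]
    _ = _ := by simp

theorem integrableOn_Ioi_pow_mul_indicator_Iic (q : ℕ) (R : ℝ) :
    IntegrableOn (fun r : ℝ => r ^ q * (Set.Iic R).indicator 1 r) (Set.Ioi 0) := by
  have h : (fun r : ℝ => r ^ q * (Set.Iic R).indicator 1 r) =
      (Set.Iic R).indicator fun r => r ^ q := by
    ext r; by_cases hr : r ∈ Set.Iic R <;> simp [hr]
  rw [h, integrableOn_indicator_iff measurableSet_Iic, Set.inter_comm, Set.Ioi_inter_Iic]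
  exact (continuous_pow q).integrableOn_Ioc

theorem integral_indicator_cone_prod_gammaPDFReal {n : ℕ} (hn : 2 ≤ n) (p : ℕ) (C : ℝ)
    (hC : ∀ f : (Fin n → ℝ) → ℝ,
      (∫ x, f x = C * ∫ z : ℝ × diagHyperplane n, f (diagSplitMap n z)) ∧
      (Integrable f → Integrable fun z : ℝ × diagHyperplane n => f (diagSplitMap n z)))
    (b : ℕ → ℝ)
    (hb : ∀ k, ∀ h : ℝ → ℝ,
      ∫ u : diagHyperplane n, diagPart n p k (u : EuclideanSpace ℝ (Fin n)) * h ‖u‖ =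
        b k * ∫ r in Set.Ioi (0 : ℝ), r ^ (k + (n - 2)) * h r)
    {t : ℝ} (ht0 : 0 ≤ t) (ht : t ≤ ((n : ℝ) - 1) ^ (-(1 / 2) : ℝ)) :
    ∫ x, {x | Real.tan (diagAngle n x) ≤ t}.indicator
        (fun x => ∏ i, gammaPDFReal ((p + 1 : ℕ) : ℝ) 1 (x i)) x =
      C * ((Real.Gamma ((p + 1 : ℕ) : ℝ) ^ n)⁻¹ *
        ∑ k ∈ Finset.range (p * n + 1), b k *
          (t ^ (k + (n - 2) + 1) / ((k + (n - 2) : ℕ) + 1)) *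
            ((1 / √n) ^ (((p + 1) * n : ℕ) : ℝ) * Real.Gamma ((p + 1) * n : ℕ))) := by
  have hn0 : (0 : ℝ) < √n := by positivity
  have hS : MeasurableSet {x : Fin n → ℝ | Real.tan (diagAngle n x) ≤ t} :=
    measurableSet_le (measurable_tan_diagAngle n) measurable_const
  have hdens : Integrable ({x | Real.tan (diagAngle n x) ≤ t}.indicator
      (fun x : Fin n → ℝ => ∏ i, gammaPDFReal ((p + 1 : ℕ) : ℝ) 1 (x i))) :=
    (integrable_prod_gammaPDFReal (by positivity) one_pos).indicator hS
  -- The hyperplane s = 0, where the tangent takes its default value 0, is null.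
  have hae : ∀ᵐ z : ℝ × diagHyperplane n, z.1 ≠ 0 :=
    Measure.quasiMeasurePreserving_fst.ae
      (compl_mem_ae_iff.2 (measure_singleton (0 : ℝ)))
  have hcongr := hae.mono fun z hz => indicator_cone_prod_gammaPDFReal hn p ht0 ht z hz
  rw [(hC _).1, integral_congr_ae hcongr]
  have hint := ((hC _).2 hdens).congr hcongr
  rw [Measure.volume_eq_prod ℝ (diagHyperplane n)] at hint ⊢
  rw [integral_prod _ hint]
  congr 1
  have hinner : ∀ s : ℝ, ∫ u : diagHyperplane n,
      (Set.Ioi (0 : ℝ)).indicator (fun s => (Real.Gamma ((p + 1 : ℕ) : ℝ) ^ n)⁻¹ *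
        (∑ k ∈ Finset.range (p * n + 1), s ^ (p * n - k) * Real.exp (-(√n * s)) *
          (diagPart n p k (u : EuclideanSpace ℝ (Fin n)) *
            (Set.Iic (t * s)).indicator 1 ‖u‖))) s =
      (Set.Ioi (0 : ℝ)).indicator (fun s => (Real.Gamma ((p + 1 : ℕ) : ℝ) ^ n)⁻¹ *
        (∑ k ∈ Finset.range (p * n + 1), b k *
          (t ^ (k + (n - 2) + 1) / ((k + (n - 2) : ℕ) + 1)) *
          (s ^ ((((p + 1) * n : ℕ) : ℝ) - 1) * Real.exp (-(√n * s))))) s := by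
    intro s
    by_cases hs : s ∈ Set.Ioi (0 : ℝ)
    · simp only [Set.indicator_of_mem hs]
      have hR : 0 ≤ t * s := mul_nonneg ht0 (Set.mem_Ioi.1 hs).le
      rw [integral_const_mul, integral_finsetSum _ fun k _ =>
        (integrable_diagPart_mul_norm hn p k ((Set.Iic (t * s)).indicator 1)
          (measurable_one.indicator measurableSet_Iic)
          (integrableOn_Ioi_pow_mul_indicator_Iic _ _)).const_mul _]
      congr 1
      refine Finset.sum_congr rfl fun k hk => ?_
      have hk' : k ≤ p * n := Nat.lt_succ_iff.1 (Finset.mem_range.1 hk)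
      rw [integral_const_mul, hb k, integral_Ioi_pow_mul_indicator_Iic _ hR, mul_pow]
      -- The total power of `s` is αn - 1 whatever `k` is, so every term yields the same factor
      -- Γ(αn) / n ^ (αn/2).
      have hpow : s ^ ((((p + 1) * n : ℕ) : ℝ) - 1) = s ^ (p * n - k) * s ^ (k + (n - 2) + 1) := by
        rw [← pow_add, ← Real.rpow_natCast]
        congr 1
        have : p * n - k + (k + (n - 2) + 1) = (p + 1) * n - 1 := by
          rw [add_mul]; omega
        rw [this, Nat.cast_sub (by rw [add_mul]; omega), Nat.cast_one]
      rw [hpow]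
      ring
    · simp only [Set.indicator_of_notMem hs, integral_zero]
  simp_rw [hinner]
  rw [integral_indicator measurableSet_Ioi, integral_const_mul]
  congr 1
  have hpos : (0 : ℝ) < (((p + 1) * n : ℕ) : ℝ) := by positivity
  have hval := Real.integral_rpow_mul_exp_neg_mul_Ioi hpos hn0
  have hG : IntegrableOn (fun s : ℝ => s ^ ((((p + 1) * n : ℕ) : ℝ) - 1) * Real.exp (-(√n * s)))
      (Set.Ioi 0) := by
    -- A non-integrable function would have integral 0 by convention, whereas this one is a positive
    -- Gamma value.
    refine Integrable.of_integral_ne_zero ?_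
    rw [hval]
    have := Real.Gamma_pos_of_pos hpos
    positivity
  rw [integral_finsetSum _ fun k _ => hG.const_mul _]
  refine Finset.sum_congr rfl fun k _ => ?_
  rw [integral_const_mul, hval]

theorem exists_integral_diagPart_mul_norm {n : ℕ} (hn : 2 ≤ n) (p : ℕ) :
    ∃ b : ℕ → ℝ, (∀ k, Odd k → b k = 0) ∧ ∀ k, ∀ h : ℝ → ℝ,
      ∫ u : diagHyperplane n, diagPart n p k (u : EuclideanSpace ℝ (Fin n)) * h ‖u‖ =
        b k * ∫ r in Set.Ioi (0 : ℝ), r ^ (k + (n - 2)) * h r := by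
  have := nontrivial_diagHyperplane hn
  choose b hb0 hb using fun k => exists_integral_homogeneous_mul_norm
    (volume : Measure (diagHyperplane n)) k
    (fun u => diagPart n p k (u : EuclideanSpace ℝ (Fin n)))
    fun r u => diagPart_smul n p k r (u : EuclideanSpace ℝ (Fin n))
  rw [finrank_diagHyperplane hn, show n - 1 - 1 = n - 2 by omega] at hb
  exact ⟨b, hb0, hb⟩

/-! ### Assembly -/

theorem theorem3p1 (α n : ℕ) (hα : 0 < α) (hn : 2 ≤ n) :
    (∃! a : Fin (topIndex α n + 1) → ℝ, SolvesCoeffSystem α n a) ∧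
    ∀ a : Fin (topIndex α n + 1) → ℝ, SolvesCoeffSystem α n a →
      ∀ {Ω : Type*} [MeasurableSpace Ω] (P : Measure Ω) [IsProbabilityMeasure P]
        (X : Fin n → Ω → ℝ),
        (∀ i, HasLaw (X i) (gammaMeasure (α : ℝ) 1) P) → iIndepFun X P →
        ∀ t : ℝ, 0 ≤ t → t ≤ ((n : ℝ) - 1) ^ (-(1 / 2) : ℝ) →
          P.real {ω | Real.tan (diagAngle n (fun i => X i ω)) ≤ t} =
            Real.Gamma ((α : ℝ) * (n : ℝ)) /
                (Real.Gamma (α : ℝ) ^ n * (n : ℝ) ^ ((α : ℝ) * (n : ℝ) / 2)) *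
              ∑ j : Fin (topIndex α n + 1),
                a j * (t ^ (n - 1 + 2 * (j : ℕ)) / ((n : ℝ) - 1 + 2 * ((j : ℕ) : ℝ))) := by
  obtain ⟨C, hC⟩ := exists_integral_eq_mul_integral_diagSplitMap hn
  obtain ⟨b, hb0, hb⟩ := exists_integral_diagPart_mul_norm hn (α - 1)
  have hsol := solvesCoeffSystem_of_integral_diagPart hn α hα C hC b hb0 hb
  refine ⟨⟨_, hsol, fun a ha => ha.unique hn hα hsol⟩, ?_⟩
  intro a ha Ω _ P _ X hX hind t ht0 ht
  -- By uniqueness any solution is the one built from polar integrals.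
  rw [ha.unique hn hα hsol]
  have hS : MeasurableSet {x : Fin n → ℝ | Real.tan (diagAngle n x) ≤ t} :=
    measurableSet_le (measurable_tan_diagAngle n) measurable_const
  have hP := measureReal_preimage_eq_integral_gammaPDFReal P X (Nat.cast_pos.2 hα) one_pos hX hind
    hS
  simp only [Set.mem_ofPred_eq] at hP
  rw [hP]
  obtain ⟨p, rfl⟩ : ∃ p, α = p + 1 := ⟨α - 1, by omega⟩
  rw [Nat.add_sub_cancel] at hb
  rw [integral_indicator_cone_prod_gammaPDFReal hn p C hC b hb ht0 ht,
    sum_range_eq_sum_range_two_mul (p * n) _ fun k hk => by rw [hb0 k hk]; ring]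
  have hN : topIndex (p + 1) n = p * n / 2 := rfl
  rw [← hN, Finset.sum_range, Finset.mul_sum, Finset.mul_sum, Finset.mul_sum]
  refine Finset.sum_congr rfl fun j _ => ?_
  have hroot : (1 / √(n : ℝ)) ^ (((p + 1) * n : ℕ) : ℝ) =
      ((n : ℝ) ^ (((p + 1 : ℕ) : ℝ) * (n : ℝ) / 2))⁻¹ := by
    rw [one_div, Real.inv_rpow (Real.sqrt_nonneg _), Real.sqrt_eq_rpow,
      ← Real.rpow_mul (Nat.cast_nonneg n), Nat.cast_mul]
    ring_nf
  have hexp : 2 * (j : ℕ) + (n - 2) + 1 = n - 1 + 2 * j := by omega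
  have hden : ((2 * (j : ℕ) + (n - 2) : ℕ) : ℝ) + 1 = (n : ℝ) - 1 + 2 * ((j : ℕ) : ℝ) := by
    rw [Nat.cast_add, Nat.cast_sub hn]
    push_cast
    ring
  rw [hroot, hexp, hden, ← Nat.cast_mul (p + 1) n]
  have h1 : Real.Gamma ((p + 1 : ℕ) : ℝ) ≠ 0 :=
    (Real.Gamma_pos_of_pos (by positivity)).ne'
  field_simp
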